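/- Let $k$ be an algebraically closed field of characteristic zero and let $X$ be a smooth projective variety over $k$ (a reduced, not necessarily irreducible, smooth projective $k$-scheme) of dimension at least one. Let $v\in H^0(X,TX)$ be a vector field on $X$, i.e. a $k$-linear derivation of the structure sheaf $\mathcal{O}_X$; its value at a point $x$ is the tangent vector $v(x)\in T_xX=\mathrm{Der}_k(\mathcal{O}_{X,x},\kappa(x))$, $f\mapsto v(f)(x)$. A closed subset $Y\subseteq X$, with its reduced structure, is called invariant for $(X,v)$ if $v|_Y$ maps $Y$ into $TY$, i.e. if for every $x\in Y$ the tangent vector $v(x)$ lies in $T_xY\subseteq T_xX$, the space of tangent vectors that annihilate the germs at $x$ of all functions vanishing on $Y$. The vector field $v$ is called wild if $X$ has no invariant closed subset $Y$ with $\emptyset\neq Y\neq X$. If $H^1(X,\mathcal{O}_X)=0$, then $v$ is not wild. -/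

import Mathlib

open CategoryTheory AlgebraicGeometry TopologicalSpace

universe u

namespace WildVectorField

noncomputable section

/-! ### Projective schemes over a field -/

attribute [local instance] MvPolynomial.gradedAlgebra

/-- Projective `n`-space `ℙⁿ` over `k`: `Proj` of `k[x₀, …, xₙ]` with its standard grading. -/
def projectiveSpace (k : Type u) [Field k] (n : ℕ) : Scheme.{u} :=
  Proj (MvPolynomial.homogeneousSubmodule (Fin (n + 1)) k)

/-- The structure morphism `ℙⁿ ⟶ Spec k`. -/
def projectiveSpaceStructure (k : Type u) [Field k] (n : ℕ) :
    projectiveSpace k n ⟶ Spec (.of k) :=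
  Proj.toSpecZero (MvPolynomial.homogeneousSubmodule (Fin (n + 1)) k) ≫
    Spec.map (CommRingCat.ofHom
      (algebraMap k (MvPolynomial.homogeneousSubmodule (Fin (n + 1)) k 0)))

/-- A `k`-scheme is projective if it admits a closed immersion over `k` into some `ℙⁿ`. -/
def IsProjective {k : Type u} [Field k] {X : Scheme.{u}} (π : X ⟶ Spec (.of k)) : Prop :=
  ∃ (n : ℕ) (i : X ⟶ projectiveSpace k n),
    IsClosedImmersion i ∧ i ≫ projectiveSpaceStructure k n = π

/-! ### Cohomology of the structure sheaf -/

/-- The structure sheaf of `X` as a sheaf of abelian groups on the Zariski site of `X`. -/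
def structureSheafAb (X : Scheme.{u}) :
    Sheaf (Opens.grothendieckTopology X) AddCommGrpCat.{u} :=
  (sheafCompose (Opens.grothendieckTopology X)
    (forget₂ CommRingCat.{u} RingCat.{u} ⋙ forget₂ RingCat.{u} AddCommGrpCat.{u})).obj X.sheaf

/-- The sheaf cohomology group `Hⁿ(X, 𝒪_X)`. -/
abbrev structureSheafCohomology (X : Scheme.{u}) (n : ℕ) : Type u :=
  (structureSheafAb X).H n

/-! ### Tangent spaces and vector fields

Throughout, `π : X ⟶ Spec k` is the structure morphism. An additive map that satisfies the Leibniz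
rule (a `ℤ`-derivation) is a `k`-derivation if and only if it is zero on the constants. -/

variable {k : Type u} [Field k] {X : Scheme.{u}}

/-- The structure map `k → Γ(X, U)`. -/
def constants (π : X ⟶ Spec (.of k)) (U : X.Opens) : k →+* Γ(X, U) :=
  ((Scheme.ΓSpecIso (.of k)).inv ≫ π.appTop ≫ X.presheaf.map (homOfLE le_top).op).hom

/-- The tangent space `T_x X`: the `k`-linear derivations `𝒪_{X,x} → κ(x)`. -/
def tangentSpace (π : X ⟶ Spec (.of k)) (x : X) :
    Submodule (X.presheaf.stalk x) (Derivation ℤ (X.presheaf.stalk x)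
      (IsLocalRing.ResidueField (X.presheaf.stalk x))) where
  carrier := {δ | ∀ c : k, δ (X.presheaf.germ ⊤ x (Opens.mem_top x) (constants π ⊤ c)) = 0}
  add_mem' ha hb c := by simp [ha c, hb c]
  zero_mem' c := by simp
  smul_mem' a δ h c := by simp [h c]

/-- For a subset `Y` of `X` (a closed one, regarded as a reduced subscheme) and `x ∈ Y`, the
subspace `T_x Y` of `T_x X`: the tangent vectors that annihilate the germs at `x` of all functions
that vanish on `Y`. -/
def tangentSpaceOf (π : X ⟶ Spec (.of k)) (Y : Set X) (x : X) :
    Submodule (X.presheaf.stalk x) (Derivation ℤ (X.presheaf.stalk x)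
      (IsLocalRing.ResidueField (X.presheaf.stalk x))) where
  carrier := {δ | δ ∈ tangentSpace π x ∧
    ∀ (U : X.Opens) (hx : x ∈ U) (f : Γ(X, U)),
      (∀ (y : X) (hy : y ∈ U), y ∈ Y → X.evaluation U y hy f = 0) →
        δ (X.presheaf.germ U x hx f) = 0}
  add_mem' ha hb := ⟨add_mem ha.1 hb.1, fun U hx f hf ↦ by
    simp [ha.2 U hx f hf, hb.2 U hx f hf]⟩
  zero_mem' := ⟨zero_mem _, fun U hx f hf ↦ by simp⟩
  smul_mem' a δ h := ⟨Submodule.smul_mem _ a h.1, fun U hx f hf ↦ by simp [h.2 U hx f hf]⟩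

/-- A vector field on `X`, i.e. a global section of the tangent sheaf `𝒟er_k(𝒪_X, 𝒪_X)`: a
`k`-linear derivation of the sheaf of rings `𝒪_X`. -/
structure VectorField (π : X ⟶ Spec (.of k)) where
  /-- The derivation on the sections over `U`. -/
  der (U : X.Opens) : Derivation ℤ Γ(X, U) Γ(X, U)
  der_constants (U : X.Opens) (c : k) : der U (constants π U c) = 0
  der_res {U V : X.Opens} (h : V ≤ U) (f : Γ(X, U)) :
    der V (X.presheaf.map (homOfLE h).op f) = X.presheaf.map (homOfLE h).op (der U f)

namespace VectorField

variable {π : X ⟶ Spec (.of k)} (v : VectorField π)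

/-- The map induced by `v` on the stalk at `x`. -/
def stalkFun (x : X) (s : X.presheaf.stalk x) : X.presheaf.stalk x :=
  X.presheaf.germ (X.presheaf.exists_germ_eq s).choose x
    (X.presheaf.exists_germ_eq s).choose_spec.choose
    (v.der _ (X.presheaf.exists_germ_eq s).choose_spec.choose_spec.choose)

theorem stalkFun_germ (x : X) (U : X.Opens) (hx : x ∈ U) (f : Γ(X, U)) :
    v.stalkFun x (X.presheaf.germ U x hx f) = X.presheaf.germ U x hx (v.der U f) := by
  set s := X.presheaf.germ U x hx f with hs
  obtain ⟨W, hW, i₁, i₂, h⟩ := X.presheaf.germ_eq x _ hx _ _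
    ((X.presheaf.exists_germ_eq s).choose_spec.choose_spec.choose_spec.trans hs)
  unfold stalkFun
  rw [← X.presheaf.germ_res_apply i₁ x hW, ← X.presheaf.germ_res_apply i₂ x hW]
  congr 1
  have h₁ := v.der_res i₁.le (X.presheaf.exists_germ_eq s).choose_spec.choose_spec.choose
  have h₂ := v.der_res i₂.le f
  exact h₁.symm.trans ((congrArg (v.der W) h).trans h₂)

theorem exists_germ₂ (x : X) (s t : X.presheaf.stalk x) :
    ∃ (U : X.Opens) (hx : x ∈ U) (f g : Γ(X, U)),
      X.presheaf.germ U x hx f = s ∧ X.presheaf.germ U x hx g = t := by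
  obtain ⟨U, hU, f, rfl⟩ := X.presheaf.exists_germ_eq s
  obtain ⟨V, hV, g, rfl⟩ := X.presheaf.exists_germ_eq t
  exact ⟨U ⊓ V, ⟨hU, hV⟩, X.presheaf.map (homOfLE inf_le_left).op f,
    X.presheaf.map (homOfLE inf_le_right).op g,
    X.presheaf.germ_res_apply _ _ _ _, X.presheaf.germ_res_apply _ _ _ _⟩

/-- The derivation of `𝒪_{X,x}` induced by `v`. -/
def stalkDer (x : X) : Derivation ℤ (X.presheaf.stalk x) (X.presheaf.stalk x) :=
  Derivation.mk'
    (AddMonoidHom.mk' (v.stalkFun x) (fun s t ↦ by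
      obtain ⟨U, hx, f, g, rfl, rfl⟩ := exists_germ₂ x s t
      rw [← map_add, stalkFun_germ, stalkFun_germ, stalkFun_germ, map_add, map_add])).toIntLinearMap
    (fun s t ↦ by
      obtain ⟨U, hx, f, g, rfl, rfl⟩ := exists_germ₂ x s t
      change v.stalkFun x _ = _ • v.stalkFun x _ + _ • v.stalkFun x _
      rw [← map_mul, stalkFun_germ, stalkFun_germ, stalkFun_germ, Derivation.leibniz]
      simp)

theorem stalkDer_germ (x : X) (U : X.Opens) (hx : x ∈ U) (f : Γ(X, U)) :
    v.stalkDer x (X.presheaf.germ U x hx f) = X.presheaf.germ U x hx (v.der U f) :=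
  v.stalkFun_germ x U hx f

/-- The value `v(x)` of the vector field `v` at the point `x`, sending the germ of a function `f` to
`v(f)(x)`. -/
def valueAt (x : X) : Derivation ℤ (X.presheaf.stalk x)
    (IsLocalRing.ResidueField (X.presheaf.stalk x)) :=
  (Algebra.linearMap (X.presheaf.stalk x)
    (IsLocalRing.ResidueField (X.presheaf.stalk x))).compDer (v.stalkDer x)

theorem valueAt_germ (x : X) (U : X.Opens) (hx : x ∈ U) (f : Γ(X, U)) :
    v.valueAt x (X.presheaf.germ U x hx f) = X.evaluation U x hx (v.der U f) :=
  congrArg (IsLocalRing.residue (X.presheaf.stalk x)) (v.stalkDer_germ x U hx f)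

/-- The values of a vector field are tangent vectors. -/
theorem valueAt_mem_tangentSpace (x : X) : v.valueAt x ∈ tangentSpace π x := fun c ↦ by
  rw [valueAt_germ, v.der_constants, map_zero]; rfl

/-- `Y` is invariant for `(X, v)` if `v|_Y` maps `Y` into `TY`, i.e. `v(x) ∈ T_x Y` for all
`x ∈ Y`. -/
def IsInvariant (Y : Set X) : Prop :=
  ∀ x ∈ Y, v.valueAt x ∈ tangentSpaceOf π Y x

/-- `v` is wild if `X` has no invariant closed subset other than `∅` and `X`. -/
def IsWild : Prop :=
  ∀ Y : Set X, IsClosed Y → Y.Nonempty → v.IsInvariant Y → Y = Set.univ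

end VectorField

end

end WildVectorField

/-!
The tangent vectors of a closed subset `Y` are described by the functions that vanish on `Y`, so `Y`
is invariant as soon as `v` preserves, locally, these functions. The proof produces a proper
nonempty invariant subset as the zero locus of a section of the line bundle `𝒪(1)` of a projective
embedding.

The closure of an open subset `W` is invariant, because on a reduced scheme a function vanishes on
`W` if and only if it restricts to zero there, and `v` commutes with restriction. Hence `X` is
integral if `v` is wild (`VectorField.IsWild.irreducibleSpace`), and sections of `𝒪_X` and of `𝒪(1)`
may be handled as elements of the function field `K`, on which `v` induces a derivation `D`. Write
`u_i = x_i / x_0` for the ratios of the homogeneous coordinates to one of them that is not zero on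
`X`; a section of `𝒪(1)` is represented by its ratio `h` to `x_0`, subject to the condition that
`h / u_j` is regular where `x_j` does not vanish.

* The logarithmic derivatives `D u_j / u_j` have regular differences, and their class in
  `H¹(X, 𝒪_X)` is the obstruction to a lift of `v` to `𝒪(1)`. As `H¹(X, 𝒪_X) = 0`, there is a
  rational function `c` such that each `D u_j / u_j - c` is regular on the `j`-th chart
  (`exists_germ_eq_sub_of_subsingleton_H_one`). This comes from the long exact sequence of the
  inclusion of `𝒪_X` into the constant sheaf `K`. Then `h ↦ D h - c h` maps the space of global
  sections of `𝒪(1)` to itself.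
* This space is finite dimensional (`finiteDimensional_of_forall_div_mem_adjoin`), because sections
  of `𝒪(1)` are almost integral over the homogeneous coordinate ring. As `k` is algebraically closed,
  the operator has an eigenvector (`HomogeneousCoordinates.exists_eigensection`).
* In each chart an eigensection is a function `s` with `v(s) = b s`. The functions vanishing on its
  zero locus form the radical of the ideal generated by `s`, and in characteristic zero this radical
  is stable under `v` (`derivation_mem_radical_span`). So the zero locus is invariant, and it is not
  all of `X`.
* The zero locus is not empty (`HomogeneousCoordinates.exists_forall_notMem_basicOpen`): otherwise
  the complement of each hyperplane `x_i = 0` would be empty or all of `X`, so `X` would be affine and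
  proper, hence a point.
-/

namespace WildVectorField

/-! ### Finite dimensionality of spaces of sections -/

section FiniteDimensional

open Polynomial

/-- The integral closure of a finitely generated domain over a field of characteristic zero in its
field of fractions is finite, by Noether normalization. -/
theorem finite_integralClosure_fractionRing (k A L : Type*) [Field k] [CharZero k] [CommRing A]
    [IsDomain A] [Algebra k A] [Algebra.FiniteType k A] [Field L] [Algebra A L]
    [IsFractionRing A L] : Module.Finite A (integralClosure A L) := by
  obtain ⟨s, g, hinj, hfin⟩ := exists_finite_inj_algHom_of_fg k A
  let P := MvPolynomial (Fin s) k
  let _ : Algebra P A := g.toRingHom.toAlgebra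
  have : Module.Finite P A := hfin
  have : FaithfulSMul P A := (faithfulSMul_iff_algebraMap_injective P A).2 hinj
  let _ : Algebra P L := ((algebraMap A L).comp (algebraMap P A)).toAlgebra
  have : IsScalarTower P A L := IsScalarTower.of_algebraMap_eq fun _ ↦ rfl
  have : FaithfulSMul P L := (faithfulSMul_iff_algebraMap_injective P L).2
    ((IsFractionRing.injective A L).comp hinj)
  let _ : Algebra (FractionRing P) L := FractionRing.liftAlgebra P L
  have : IsScalarTower P (FractionRing P) L := FractionRing.isScalarTower_liftAlgebra P L
  have : CharZero P := charZero_of_injective_algebraMap (MvPolynomial.C_injective (Fin s) k)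
  have : CharZero (FractionRing P) :=
    charZero_of_injective_algebraMap (IsFractionRing.injective P (FractionRing P))
  have : IsLocalization (Algebra.algebraMapSubmonoid A (nonZeroDivisors P)) L := inferInstance
  have : FiniteDimensional (FractionRing P) L :=
    Module.Finite.of_isLocalization P A (nonZeroDivisors P)
  have : IsNoetherian P (integralClosure P L) :=
    IsIntegralClosure.isNoetherian P (FractionRing P) L (integralClosure P L)
  have hle (x : integralClosure A L) : (x : L) ∈ integralClosure P L :=
    isIntegral_trans (x : L) x.2
  let f : integralClosure A L →ₗ[P] integralClosure P L :=
    LinearMap.codRestrict (Subalgebra.toSubmodule (integralClosure P L))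
      ((integralClosure A L).val.toLinearMap.restrictScalars P) hle
  have : Module.Finite P (integralClosure A L) :=
    Module.Finite.of_injective f fun x y h ↦
      Subtype.ext (congrArg (fun z : integralClosure P L ↦ (z : L)) h)
  exact Module.Finite.of_restrictScalars_finite P A (integralClosure A L)

/-- A module generated by almost integral elements over a finitely generated domain `A` embeds into
the integral closure of `A` in `Frac A`, so it is finitely generated. -/
theorem fg_span_of_isAlmostIntegral (k : Type*) {A R : Type*} [Field k] [CharZero k] [CommRing A]
    [IsDomain A] [Algebra k A] [Algebra.FiniteType k A] [CommRing R] [IsDomain R] [Algebra A R]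
    [FaithfulSMul A R] {Z : Set R} (hZ : ∀ x ∈ Z, IsAlmostIntegral A x) :
    (Submodule.span A Z).FG := by
  have : IsNoetherianRing A := Algebra.FiniteType.isNoetherianRing k A
  let L' := FractionRing R
  have : FaithfulSMul A L' := (faithfulSMul_iff_algebraMap_injective A L').2 <| by
    rw [IsScalarTower.algebraMap_eq A R L']
    exact (IsFractionRing.injective R L').comp (FaithfulSMul.algebraMap_injective A R)
  let _ : Algebra (FractionRing A) L' := FractionRing.liftAlgebra A L'
  have : IsScalarTower A (FractionRing A) L' := FractionRing.isScalarTower_liftAlgebra A L'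
  have := finite_integralClosure_fractionRing k A (FractionRing A)
  let j : integralClosure A (FractionRing A) →ₗ[A] L' :=
    (IsScalarTower.toAlgHom A (FractionRing A) L').toLinearMap ∘ₗ
      (integralClosure A (FractionRing A)).val.toLinearMap
  have : IsNoetherian A (LinearMap.range j) := isNoetherian_of_isNoetherianRing_of_finite A _
  let e : R →ₗ[A] L' := (IsScalarTower.toAlgHom A R L').toLinearMap
  have he : Function.Injective e := IsFractionRing.injective R L'
  have hle : Submodule.span A Z ≤ (LinearMap.range j).comap e := by
    refine Submodule.span_le.2 fun x hx ↦ ?_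
    have hint : IsIntegral A (algebraMap R L' x) := (hZ x hx).isIntegral.algebraMap
    obtain ⟨r, hr, H⟩ := hZ x hx
    obtain ⟨a, ha⟩ := H 1
    have hr0 : algebraMap A L' r ≠ 0 := by
      simpa using (nonZeroDivisors.ne_zero hr)
    have hy : algebraMap (FractionRing A) L' (algebraMap A _ a / algebraMap A _ r) =
        algebraMap R L' x := by
      rw [map_div₀, ← IsScalarTower.algebraMap_apply, ← IsScalarTower.algebraMap_apply,
        div_eq_iff hr0, IsScalarTower.algebraMap_apply A R L' a, ha,
        IsScalarTower.algebraMap_apply A R L' r, ← map_mul, pow_one, Algebra.smul_def, mul_comm]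
    refine ⟨⟨_, ?_⟩, hy⟩
    rw [← hy] at hint
    exact (isIntegral_algebraMap_iff (FaithfulSMul.algebraMap_injective _ _)).1 hint
  have : IsNoetherian A (Submodule.span A Z) :=
    isNoetherian_of_injective (e.restrict (q := LinearMap.range j) fun x hx ↦ hle hx) fun x y h ↦
      Subtype.ext (he (congrArg Subtype.val h))
  exact (Submodule.fg_top _).1 (IsNoetherian.noetherian _)

variable {k K : Type*} [Field k] [Field K] [Algebra k K]

/-- An element of `k[uᵢ / a]` is a homogeneous form of some degree `N` in the `uᵢ`, divided by
`a ^ N`. -/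
theorem exists_mul_pow_mem_span_pow {ι : Type*} (u : ι → K) {a : K} (ha : a ≠ 0) {x : K}
    (hx : x ∈ Algebra.adjoin k (Set.range fun i ↦ u i / a))
    (haV : a ∈ Submodule.span k (Set.range u)) :
    ∃ N : ℕ, x * a ^ N ∈ Submodule.span k (Set.range u) ^ N := by
  set V := Submodule.span k (Set.range u)
  induction hx using Algebra.adjoin_induction with
  | mem x hx =>
    obtain ⟨i, rfl⟩ := hx
    refine ⟨1, ?_⟩
    rw [pow_one, pow_one, div_mul_cancel₀ _ ha]
    exact Submodule.subset_span ⟨i, rfl⟩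
  | algebraMap c => exact ⟨0, by simp⟩
  | add x y _ _ hx hy =>
    obtain ⟨N, hN⟩ := hx
    obtain ⟨M, hM⟩ := hy
    refine ⟨N + M, ?_⟩
    rw [add_mul]
    refine add_mem ?_ ?_
    · rw [pow_add a, ← mul_assoc, pow_add]
      exact Submodule.mul_mem_mul hN (Submodule.pow_mem_pow _ haV _)
    · rw [add_comm N M, pow_add a, ← mul_assoc, pow_add]
      exact Submodule.mul_mem_mul hM (Submodule.pow_mem_pow _ haV _)
  | mul x y _ _ hx hy =>
    obtain ⟨N, hN⟩ := hx
    obtain ⟨M, hM⟩ := hy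
    refine ⟨N + M, ?_⟩
    rw [show x * y * a ^ (N + M) = (x * a ^ N) * (y * a ^ M) by ring, pow_add]
    exact Submodule.mul_mem_mul hN hM

theorem prod_mem_pow_card {ι : Type*} (V : Submodule k K) (s : Finset ι) (f : ι → K)
    (hf : ∀ i ∈ s, f i ∈ V) : ∏ i ∈ s, f i ∈ V ^ s.card := by
  classical
  induction s using Finset.induction_on with
  | empty => simp
  | insert i s hi ih =>
    rw [Finset.prod_insert hi, Finset.card_insert_of_notMem hi, pow_succ']
    exact Submodule.mul_mem_mul (hf i (by simp)) (ih fun j hj ↦ hf j (by simp [hj]))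

/-- Pigeonhole: a monomial of large degree in the finitely many `uᵢ` is divisible by the `N`-th
power of one of them. Hence an element that multiplies each `uᵢ ^ N` into `V ^ (N + 1)`, where `V`
is the span of the `uᵢ`, multiplies `V ^ m` into `V ^ (m + 1)` for large `m`. -/
theorem exists_forall_mul_mem_span_pow {ι : Type*} [Finite ι] [Nonempty ι] (u : ι → K) {h : K}
    (hu : ∀ i, ∃ N, h * u i ^ N ∈ Submodule.span k (Set.range u) ^ (N + 1)) :
    ∃ m : ℕ, ∀ n ≥ m, ∀ x ∈ Submodule.span k (Set.range u) ^ n,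
      h * x ∈ Submodule.span k (Set.range u) ^ (n + 1) := by
  classical
  cases nonempty_fintype ι
  set V := Submodule.span k (Set.range u) with hV
  have huV (i : ι) : u i ∈ V := Submodule.subset_span ⟨i, rfl⟩
  choose N hN using hu
  let M := Finset.univ.sup N
  have hM (i : ι) (n : ℕ) (hn : M ≤ n) : h * u i ^ n ∈ V ^ (n + 1) := by
    obtain ⟨d, rfl⟩ := Nat.exists_eq_add_of_le ((Finset.le_sup (Finset.mem_univ i)).trans hn)
    rw [pow_add (u i), ← mul_assoc, add_right_comm, pow_add]
    exact Submodule.mul_mem_mul (hN i) (Submodule.pow_mem_pow _ (huV i) _)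
  refine ⟨Fintype.card ι * M, fun n hn x hx ↦ ?_⟩
  rw [hV, Submodule.span_pow] at hx
  induction hx using Submodule.span_induction with
  | zero => simp
  | add x y _ _ hx hy => rw [mul_add]; exact add_mem hx hy
  | smul c x _ hx => rw [mul_smul_comm]; exact Submodule.smul_mem _ _ hx
  | mem x hx =>
    obtain ⟨f, rfl⟩ := Set.mem_pow.1 hx
    choose g hg using fun i ↦ (f i).2
    rw [List.prod_ofFn]
    simp_rw [← hg]
    obtain ⟨j, -, hj⟩ := Finset.exists_le_card_fiber_of_mul_le_card_of_maps_to
      (s := (Finset.univ : Finset (Fin n))) (t := (Finset.univ : Finset ι)) (f := g) (n := M)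
      (fun _ _ ↦ Finset.mem_univ _) Finset.univ_nonempty (by simpa using hn)
    set s := Finset.univ.filter fun i ↦ g i = j
    rw [← Finset.prod_mul_prod_compl s,
      Finset.prod_congr rfl (g := fun _ ↦ u j) (fun i hi ↦ by rw [(Finset.mem_filter.1 hi).2]),
      Finset.prod_const, ← mul_assoc,
      show n + 1 = (s.card + 1) + sᶜ.card by
        have := s.card_add_card_compl; rw [Fintype.card_fin] at this; omega, pow_add]
    exact Submodule.mul_mem_mul (hM j _ hj) (prod_mem_pow_card V _ _ fun i _ ↦ huV _)

/-- The space of sections of a line bundle `𝒪(1)` is finite dimensional. Here `u i` is the ratio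
`xᵢ / x₀` of homogeneous coordinates in the function field `K`, and a section is represented by its
ratio `h` to `x₀`. In `K[T]`, the elements `h T` are almost integral over the homogeneous
coordinate ring `A = k[uᵢ T]`, so they generate a finite `A`-module; finitely many of them span all
of them over `k`, because the elements of `A` have constant terms in `k`. -/
theorem finiteDimensional_of_forall_div_mem_adjoin [CharZero k] {ι : Type*} [Finite ι]
    (u : ι → K) {i₀ : ι} (h₀ : u i₀ = 1) (S : Submodule k K)
    (hS : ∀ h ∈ S, ∀ j, u j ≠ 0 → h / u j ∈ Algebra.adjoin k (Set.range fun i ↦ u i / u j)) :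
    FiniteDimensional k S := by
  have : Nonempty ι := ⟨i₀⟩
  set V := Submodule.span k (Set.range u) with hV
  have huV (i : ι) : u i ∈ V := Submodule.subset_span ⟨i, rfl⟩
  have h1V : (1 : K) ∈ V := h₀ ▸ huV i₀
  let A : Subalgebra k K[X] := Algebra.adjoin k (Set.range fun i ↦ C (u i) * X)
  have : Algebra.FiniteType k A := ⟨(Subalgebra.fg_top A).2
    (Subalgebra.fg_def.2 ⟨_, Set.finite_range _, rfl⟩)⟩
  have hVA (n : ℕ) (x : K) (hx : x ∈ V ^ n) : C x * X ^ n ∈ A := by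
    induction n generalizing x with
    | zero =>
      obtain ⟨c, rfl⟩ := Submodule.mem_one.1 (by simpa using hx)
      simpa using A.algebraMap_mem c
    | succ n ih =>
      rw [pow_succ] at hx
      induction hx using Submodule.mul_induction_on' with
      | mem_mul_mem x hx y hy =>
        have hy' : C y * X ∈ A := by
          induction hy using Submodule.span_induction with
          | zero => simp
          | add x y _ _ hx hy => rw [map_add, add_mul]; exact add_mem hx hy
          | smul c x _ hx =>
            rw [← smul_C, smul_mul_assoc]; exact A.smul_mem hx c
          | mem x hx => obtain ⟨i, rfl⟩ := hx; exact Algebra.subset_adjoin ⟨i, rfl⟩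
        rw [show C (x * y) * X ^ (n + 1) = (C x * X ^ n) * (C y * X) by rw [map_mul]; ring]
        exact mul_mem (ih x hx) hy'
      | add x _ y _ hx hy => rw [map_add, add_mul]; exact add_mem hx hy
  have hcoeff (p : K[X]) (hp : p ∈ A) : p.coeff 0 ∈ (algebraMap k K).range := by
    have : A ≤ ((⊥ : Subalgebra k K).comap (aeval (R := K) (0 : K) |>.restrictScalars k)) := by
      refine Algebra.adjoin_le ?_
      rintro _ ⟨i, rfl⟩
      simp
    obtain ⟨c, hc⟩ := Algebra.mem_bot.1 (this hp)
    exact ⟨c, by rw [hc]; simp [coeff_zero_eq_aeval_zero]⟩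
  let Z : Set K[X] := (fun h ↦ C h * X) '' (S : Set K)
  have hZ : ∀ x ∈ Z, IsAlmostIntegral A x := by
    rintro _ ⟨h, hh, rfl⟩
    obtain ⟨m, hm⟩ := exists_forall_mul_mem_span_pow (k := k) u (h := h) fun j ↦ by
      by_cases hj : u j = 0
      · exact ⟨1, by simp [hj]⟩
      · obtain ⟨N, hN⟩ := exists_mul_pow_mem_span_pow u hj (hS h hh j hj) (huV j)
        refine ⟨N, ?_⟩
        rw [pow_succ, show h * u j ^ N = h / u j * u j ^ N * u j by field_simp]
        exact Submodule.mul_mem_mul hN (huV j)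
    have hpow (n : ℕ) : h ^ n ∈ V ^ (m + n) := by
      induction n with
      | zero => simpa using Submodule.pow_mem_pow V h1V m
      | succ n ih => rw [pow_succ', ← add_assoc]; exact hm _ (by omega) _ ih
    refine ⟨⟨C (1 : K) * X ^ m, hVA m 1 (by simpa using Submodule.pow_mem_pow V h1V m)⟩,
      mem_nonZeroDivisors_of_ne_zero fun h ↦ ?_, fun n ↦ ⟨⟨_, hVA _ _ (hpow n)⟩, ?_⟩⟩
    · simpa using congrArg Subtype.val h
    · rw [Algebra.smul_def]
      change C (h ^ n) * X ^ (m + n) = C 1 * X ^ m * (C h * X) ^ n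
      rw [map_one, map_pow]; ring
  obtain ⟨t, ht, hspan⟩ := (Submodule.fg_span_iff_fg_span_finset_subset Z).1
    (fg_span_of_isAlmostIntegral k hZ)
  let W : Submodule k K := Submodule.span k ((fun p ↦ p.coeff 1) '' (t : Set K[X]))
  have : FiniteDimensional k W := FiniteDimensional.span_of_finite k (t.finite_toSet.image _)
  refine Submodule.finiteDimensional_of_le (S₂ := W) fun h hh ↦ ?_
  have hmem : C h * X ∈ Submodule.span A (t : Set K[X]) := hspan ▸ Submodule.subset_span ⟨h, hh, rfl⟩
  have key : ∀ p ∈ Submodule.span A (t : Set K[X]), p.coeff 0 = 0 ∧ p.coeff 1 ∈ W := by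
    intro p hp
    induction hp using Submodule.span_induction with
    | zero => simp
    | add x y _ _ hx hy => simpa [hx.1, hy.1] using add_mem hx.2 hy.2
    | mem x hx =>
      refine ⟨?_, Submodule.subset_span ⟨x, hx, rfl⟩⟩
      obtain ⟨h, -, rfl⟩ := ht hx
      simp
    | smul a x _ hx =>
      obtain ⟨c, hc⟩ := hcoeff a a.2
      have h1 : (a • x).coeff 1 = c • x.coeff 1 := by
        rw [Algebra.smul_def c, hc, Algebra.smul_def a]
        change ((a : K[X]) * x).coeff 1 = _
        rw [coeff_mul, Finset.Nat.antidiagonal_succ]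
        simp [hx.1]
      refine ⟨?_, h1 ▸ Submodule.smul_mem _ _ hx.2⟩
      rw [Algebra.smul_def a]
      change ((a : K[X]) * x).coeff 0 = _
      rw [mul_coeff_zero, hx.1, mul_zero]
  simpa using (key _ hmem).2

end FiniteDimensional

/-! ### Derivations and radicals -/

/-- In characteristic zero, the radical of a principal ideal that is stable under a derivation `D` is
stable too: if `f ^ m` lies in the ideal, then so does `D f ^ (2 * m)`. -/
theorem derivation_mem_radical_span {R : Type*} [CommRing R] (hR : ∀ n : ℕ, IsUnit ((n + 1 : ℕ) : R))
    (D : Derivation ℤ R R) {s b f : R} (hs : D s = b * s) (hf : f ∈ (Ideal.span {s}).radical) :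
    D f ∈ (Ideal.span {s}).radical := by
  set I := Ideal.span {s}
  have hD {x : R} (hx : x ∈ I) : D x ∈ I := by
    obtain ⟨a, rfl⟩ := Ideal.mem_span_singleton'.1 hx
    rw [D.leibniz, hs]
    exact Ideal.mem_span_singleton'.2 ⟨a * b + D a, by simp only [smul_eq_mul]; ring⟩
  obtain ⟨m, hm⟩ := hf
  have key (i : ℕ) : ∀ e, e + i = m → f ^ e * D f ^ (2 * i) ∈ I := by
    induction i with
    | zero => rintro e rfl; simpa using hm
    | succ i ih =>
      intro e he
      have h := ih (e + 1) (by omega)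
      -- Differentiate, multiply by `D f`, and drop the term that lies in `I` already.
      have h' : ((e + 1 : ℕ) : R) * (f ^ e * D f ^ (2 * (i + 1))) =
          D f * D (f ^ (e + 1) * D f ^ (2 * i)) -
            (2 * i : ℕ) * D (D f) * (f ^ (e + 1) * D f ^ (2 * i)) := by
        rw [D.leibniz, D.leibniz_pow, D.leibniz_pow]
        simp only [smul_eq_mul, nsmul_eq_mul, add_tsub_cancel_right]
        cases i with
        | zero => simp; ring
        | succ i =>
          rw [show 2 * (i + 1) - 1 = 2 * i + 1 by omega]
          push_cast
          ring
      exact (Ideal.unit_mul_mem_iff_mem I (hR e)).1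
        (h' ▸ sub_mem (I.mul_mem_left _ (hD h)) (I.mul_mem_left _ h))
  exact ⟨2 * m, by simpa using key m 0 (by omega)⟩

/-! ### Cocycles and the first cohomology group -/

section Cohomology

open Opposite Limits

/-- If `H¹(F) = 0` and `F` is a subsheaf of `G`, then a family of local sections of `G` whose
differences lie in `F`, i.e. a global section of `G / F`, comes from a global section of `G`. -/
theorem exists_section_of_subsingleton_H_one {X : TopCat.{u}}
    {F G : Sheaf (Opens.grothendieckTopology X) AddCommGrpCat.{u}} (φ : F ⟶ G) [Mono φ]
    (hF : Subsingleton (F.H 1)) {ι : Type*} (U : ι → Opens X) (hU : ⨆ i, U i = ⊤)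
    (g : ∀ i, G.obj.obj (op (U i)))
    (hg : ∀ i j, ∃ f : F.obj.obj (op (U i ⊓ U j)),
      φ.hom.app (op (U i ⊓ U j)) f = G.obj.map (homOfLE inf_le_left).op (g i) -
        G.obj.map (homOfLE inf_le_right).op (g j)) :
    ∃ t : G.obj.obj (op ⊤), ∀ i, ∃ f : F.obj.obj (op (U i)),
      φ.hom.app (op (U i)) f = g i - G.obj.map (homOfLE le_top).op t := by
  let S : ShortComplex (Sheaf (Opens.grothendieckTopology X) AddCommGrpCat.{u}) :=
    ShortComplex.mk φ (cokernel.π φ) (cokernel.condition φ)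
  have hS : S.ShortExact := { exact := ShortComplex.exact_of_g_is_cokernel _ (cokernelIsCokernel φ) }
  have hzero (W : Opens X) (f : F.obj.obj (op W)) :
      S.g.hom.app (op W) (φ.hom.app (op W) f) = 0 := by
    rw [← ConcreteCategory.comp_apply, ← NatTrans.comp_app,
      ← ObjectProperty.FullSubcategory.comp_hom, S.zero]
    rfl
  have hnat {W W' : Opens X} (h : W ≤ W') (x : G.obj.obj (op W')) :
      S.g.hom.app (op W) (G.obj.map (homOfLE h).op x) =
        S.X₃.obj.map (homOfLE h).op (S.g.hom.app (op W') x) :=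
    ConcreteCategory.congr_hom (S.g.hom.naturality (homOfLE h).op) x
  obtain ⟨q, hq, -⟩ := TopCat.Sheaf.existsUnique_gluing' S.X₃ U ⊤ (fun i ↦ homOfLE le_top) hU.ge
    (fun i ↦ S.g.hom.app (op (U i)) (g i)) (fun i j ↦ by
      obtain ⟨f, hf⟩ := hg i j
      have := hzero _ f
      rw [hf, map_sub, sub_eq_zero, hnat, hnat] at this
      exact this)
  obtain ⟨x, hx⟩ := Abelian.Ext.covariant_sequence_exact₃ _ hS
    ((Sheaf.H.equiv₀ S.X₃ isTerminalTop).symm q) (zero_add 1) (hF.elim _ _)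
  let t := Sheaf.H.equiv₀ G isTerminalTop x
  have ht : S.g.hom.app (op ⊤) t = q := by
    rw [Sheaf.H.equiv₀_naturality, Sheaf.H.map_apply]
    erw [hx]
    simp
  refine ⟨t, fun i ↦ TopCat.Sheaf.sections_exact_of_left_exact hS.1 hS.2 _ ?_⟩
  change S.g.hom.app (op (U i)) _ = 0
  rw [map_sub, hnat, ht, sub_eq_zero]
  exact (hq i).symm

/-- Suppose that `H¹(F) = 0`, and that the sections of `F` over the open sets containing `p` embed
compatibly into a group `A`, while there is no nonzero section over the other open sets. Then a
family of elements of `A`, indexed by an open cover, whose differences come from sections of `F`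
over the intersections, can be corrected by a constant so that its members come from sections. -/
theorem exists_sub_mem_range_of_subsingleton_H_one {X : TopCat.{u}}
    (F : Sheaf (Opens.grothendieckTopology X) AddCommGrpCat.{u}) (hF : Subsingleton (F.H 1))
    (p : X) (A : AddCommGrpCat.{u}) (ψ : ∀ U : Opens X, p ∈ U → (F.obj.obj (op U) ⟶ A))
    (hψ : ∀ (U V : Opens X) (h : V ≤ U) (hp : p ∈ V),
      F.obj.map (homOfLE h).op ≫ ψ V hp = ψ U (h hp))
    (hinj : ∀ U hp, Function.Injective (ψ U hp))
    (htriv : ∀ U : Opens X, p ∉ U → Subsingleton (F.obj.obj (op U)))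
    {ι : Type*} (U : ι → Opens X) (hp : ∀ i, p ∈ U i) (hU : ⨆ i, U i = ⊤) (a : ι → A)
    (ha : ∀ i j, ∃ f, ψ (U i ⊓ U j) ⟨hp i, hp j⟩ f = a i - a j) :
    ∃ c : A, ∀ i, ∃ f, ψ (U i) (hp i) f = a i - c := by
  classical
  -- `F` embeds into the skyscraper sheaf at `p` with value `A`.
  let G : Sheaf (Opens.grothendieckTopology X) AddCommGrpCat.{u} := skyscraperSheaf p A
  let e (W : Opens X) (h : p ∈ W) : A ≅ G.obj.obj (op W) := eqToIso (if_pos h).symm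
  have he (W W' : Opens X) (h : W ≤ W') (hW : p ∈ W) :
      (e W' (h hW)).hom ≫ G.obj.map (homOfLE h).op = (e W hW).hom := by
    change eqToHom (if_pos (h hW)).symm ≫ (skyscraperPresheaf p A).map (homOfLE h).op =
      eqToHom (if_pos hW).symm
    rw [skyscraperPresheaf_map, dif_pos hW]
    exact eqToHom_trans _ _
  let φ : F ⟶ G := ⟨
    { app W := if h : p ∈ W.unop then ψ W.unop h ≫ (e W.unop h).hom
        else (isTerminalSkyscraperSheafObjObjOfNotMem h).from _
      naturality W W' i := by
        by_cases hW' : p ∈ W'.unop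
        · have hW : p ∈ W.unop := i.unop.le hW'
          rw [dif_pos hW, dif_pos hW', ← Category.assoc]
          erw [hψ _ _ i.unop.le hW']
          rw [Category.assoc]
          erw [he _ _ i.unop.le hW']
        · exact (isTerminalSkyscraperSheafObjObjOfNotMem hW').hom_ext _ _ }⟩
  have hφ (W : Opens X) (h : p ∈ W) : φ.hom.app (op W) = ψ W h ≫ (e W h).hom := dif_pos h
  have hmono (W : (Opens X)ᵒᵖ) : Mono (φ.hom.app W) := by
    refine (AddCommGrpCat.mono_iff_injective _).2 ?_
    by_cases h : p ∈ W.unop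
    · intro x y hxy
      rw [hφ W.unop h] at hxy
      exact hinj _ h ((ConcreteCategory.bijective_of_isIso (e W.unop h).hom).1 hxy)
    · have := htriv W.unop h
      exact Function.injective_of_subsingleton _
  have : Mono φ.hom := NatTrans.mono_of_mono_app _
  have : Mono φ := Sheaf.Hom.mono_of_presheaf_mono _ _ φ
  obtain ⟨t, ht⟩ := exists_section_of_subsingleton_H_one φ hF U hU
    (fun i ↦ (e (U i) (hp i)).hom (a i)) fun i j ↦ by
      obtain ⟨f, hf⟩ := ha i j
      refine ⟨f, ?_⟩
      have hij : p ∈ U i ⊓ U j := ⟨hp i, hp j⟩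
      rw [hφ _ hij, ConcreteCategory.comp_apply, hf, ← ConcreteCategory.comp_apply,
        ← ConcreteCategory.comp_apply, he _ _ _ hij, he _ _ _ hij, map_sub]
  refine ⟨(e ⊤ (Opens.mem_top p)).inv t, fun i ↦ ?_⟩
  obtain ⟨f, hf⟩ := ht i
  refine ⟨f, ?_⟩
  have h1 : G.obj.map (homOfLE le_top).op t =
      (e (U i) (hp i)).hom ((e ⊤ (Opens.mem_top p)).inv t) := by
    rw [← he (U i) ⊤ le_top (hp i), ← ConcreteCategory.comp_apply, Iso.inv_hom_id_assoc]
  rw [h1, hφ _ (hp i), ConcreteCategory.comp_apply, ← map_sub] at hf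
  exact (ConcreteCategory.bijective_of_isIso (e (U i) (hp i)).hom).1 hf

end Cohomology

/-! ### Homogeneous coordinates -/

section Coordinates

variable {k : Type u} [Field k]

/-- A system of homogeneous coordinates `x₀, …, xₙ` on a `k`-scheme `X`, as given by an embedding
into `ℙⁿ`. Only the ratios of the coordinates are recorded. -/
structure HomogeneousCoordinates {X : Scheme.{u}} (π : X ⟶ Spec (.of k)) (n : ℕ) where
  /-- The open set `U j` where `x_j` does not vanish. -/
  U (j : Fin (n + 1)) : X.Opens
  /-- The function `x_i / x_j` on `U j`. -/
  ratio (i j : Fin (n + 1)) : Γ(X, U j)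
  isAffineOpen (j : Fin (n + 1)) : IsAffineOpen (U j)
  iSup_eq_top : ⨆ j, U j = ⊤
  ratio_self (j : Fin (n + 1)) : ratio j j = 1
  ratio_mul (i j l : Fin (n + 1)) (W : X.Opens) (hj : W ≤ U j) (hl : W ≤ U l) :
    X.presheaf.map (homOfLE hj).op (ratio i j) * X.presheaf.map (homOfLE hl).op (ratio j l) =
      X.presheaf.map (homOfLE hl).op (ratio i l)
  basicOpen_ratio_le (i j : Fin (n + 1)) : X.basicOpen (ratio i j) ≤ U i
  /-- The functions on `U j` are polynomials in the ratios. -/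
  exists_eval₂_eq (j : Fin (n + 1)) (s : Γ(X, U j)) : ∃ p : MvPolynomial (Fin (n + 1)) k,
    p.eval₂ (constants π (U j)) (fun i ↦ ratio i j) = s

theorem constants_comp {X Y : Scheme.{u}} (i : X ⟶ Y) (π : Y ⟶ Spec (.of k)) (V : Y.Opens) :
    constants (i ≫ π) (i ⁻¹ᵁ V) = (i.app V).hom.comp (constants π V) := by
  rw [constants, constants, ← CommRingCat.hom_comp]
  congr 1
  simp only [Scheme.Hom.comp_appTop, Category.assoc]
  congr 2
  exact (i.naturality (homOfLE le_top).op).symm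

/-- Homogeneous coordinates restrict to closed subschemes. -/
noncomputable def HomogeneousCoordinates.pullback {X Y : Scheme.{u}} {π : Y ⟶ Spec (.of k)} {n : ℕ}
    (c : HomogeneousCoordinates π n) (i : X ⟶ Y) [IsClosedImmersion i] :
    HomogeneousCoordinates (i ≫ π) n where
  U j := i ⁻¹ᵁ c.U j
  ratio a j := i.app (c.U j) (c.ratio a j)
  isAffineOpen j := (c.isAffineOpen j).preimage i
  iSup_eq_top := by
    rw [← Scheme.Hom.preimage_iSup, c.iSup_eq_top, Scheme.Hom.preimage_top]
  ratio_self j := by rw [c.ratio_self, map_one]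
  ratio_mul a j l W hj hl := by
    have h (m : Fin (n + 1)) (hm : W ≤ i ⁻¹ᵁ c.U m) (V : Y.Opens) (hV : V ≤ c.U m)
        (hW : W ≤ i ⁻¹ᵁ V) (s : Γ(Y, c.U m)) : X.presheaf.map (homOfLE hm).op (i.app (c.U m) s) =
        X.presheaf.map (homOfLE hW).op (i.app V (Y.presheaf.map (homOfLE hV).op s)) := by
      have := ConcreteCategory.congr_hom (i.naturality (homOfLE hV).op) s
      rw [ConcreteCategory.comp_apply] at this
      rw [this]
      exact ConcreteCategory.congr_hom
        (X.presheaf.map_comp ((Opens.map i.base).map (homOfLE hV).op.unop).op (homOfLE hW).op)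
        (i.app (c.U m) s)
    have hW : W ≤ i ⁻¹ᵁ (c.U j ⊓ c.U l) := le_inf hj hl
    rw [h j hj _ inf_le_left hW, h l hl _ inf_le_right hW, h l hl _ inf_le_right hW, ← map_mul,
      ← map_mul, c.ratio_mul]
  basicOpen_ratio_le a j := by
    rw [← Scheme.preimage_basicOpen]
    exact fun x hx ↦ c.basicOpen_ratio_le a j hx
  exists_eval₂_eq j s := by
    obtain ⟨t, rfl⟩ := i.app_surjective (c.U j) (c.isAffineOpen j) s
    obtain ⟨p, rfl⟩ := c.exists_eval₂_eq j t
    refine ⟨p, ?_⟩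
    rw [MvPolynomial.hom_eval₂, constants_comp]

theorem eval₂_mul_of_isHomogeneous {R S σ : Type*} [CommRing R] [CommRing S] (f : R →+* S)
    (c : S) (g : σ → S) {p : MvPolynomial σ R} {n : ℕ} (hp : p.IsHomogeneous n) :
    p.eval₂ f (fun i ↦ c * g i) = c ^ n * p.eval₂ f g := by
  rw [MvPolynomial.eval₂_eq, MvPolynomial.eval₂_eq, Finset.mul_sum]
  refine Finset.sum_congr rfl fun d hd ↦ ?_
  have : c ^ n = ∏ i ∈ d.support, c ^ d i := by
    rw [Finset.prod_pow_eq_pow_sum, ← hp (MvPolynomial.mem_support_iff.1 hd)]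
    simp [Finsupp.weight_apply, Finsupp.sum]
  rw [this]
  simp_rw [mul_pow]
  rw [Finset.prod_mul_distrib]
  ring

theorem constants_eq_of_ι_comp_eq {X : Scheme.{u}} (π : X ⟶ Spec (.of k)) (U : X.Opens)
    (φ : CommRingCat.of k ⟶ Γ(X, U)) (h : U.ι ≫ π = U.toSpecΓ ≫ Spec.map φ) :
    constants π U = φ.hom := by
  have h1 := congrArg (fun f ↦ (Scheme.ΓSpecIso (.of k)).inv ≫ f.appTop ≫ U.topIso.hom) h
  rw [constants]
  congr 1
  simp only [Scheme.Hom.comp_appTop, Scheme.Opens.toSpecΓ_appTop, Category.assoc,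
    Iso.inv_hom_id, Category.comp_id] at h1
  rw [← Scheme.ΓSpecIso_inv_naturality_assoc, Iso.inv_hom_id, Category.comp_id] at h1
  rw [← h1, Scheme.Opens.ι_appTop, Scheme.Opens.topIso_hom]
  congr 2
  exact X.presheaf.map_comp (homOfLE le_top).op (eqToHom U.ι_image_top.symm).op

open HomogeneousLocalization in
theorem basicOpen_awayToSection_mk_le {A σ : Type u} [CommRing A] [SetLike σ A]
    [AddSubgroupClass σ A] (𝒜 : ℕ → σ) [GradedRing 𝒜] {f : A} {d : ℕ} (hf : f ∈ 𝒜 d) (m : ℕ)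
    (a : A) (ha : a ∈ 𝒜 (m • d)) :
    (Proj 𝒜).basicOpen (Proj.awayToSection 𝒜 f (Away.mk 𝒜 hf m a ha)) ≤ Proj.basicOpen 𝒜 a := by
  intro x hx
  obtain ⟨hxf, hu⟩ := (Scheme.mem_basicOpen'' _ _ _).1 hx
  have : x.asHomogeneousIdeal.toIdeal.IsPrime := x.isPrime
  have hle : Submonoid.powers f ≤ x.asHomogeneousIdeal.toIdeal.primeCompl :=
    Submonoid.powers_le.mpr hxf
  have hu' : IsUnit (mapId 𝒜 hle (Away.mk 𝒜 hf m a ha)) := by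
    have h := ConcreteCategory.congr_hom
      (ProjectiveSpectrum.Proj.awayToSection_germ 𝒜 f x hxf) (Away.mk 𝒜 hf m a ha)
    have hu2 : IsUnit ((Proj.stalkIso 𝒜 x).inv (mapId 𝒜 hle (Away.mk 𝒜 hf m a ha))) :=
      (congrArg IsUnit h).mp hu
    have h2 := hu2.map (Proj.stalkIso 𝒜 x).hom.hom
    rwa [← ConcreteCategory.comp_apply, Iso.inv_hom_id] at h2
  rw [← isUnit_iff_isUnit_val] at hu'
  change IsUnit (Localization.mk a (⟨f ^ m, hle ⟨m, rfl⟩⟩ :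
    x.asHomogeneousIdeal.toIdeal.primeCompl)) at hu'
  rw [Localization.mk_eq_mk'] at hu'
  exact (IsLocalization.AtPrime.isUnit_mk'_iff _ x.asHomogeneousIdeal.toIdeal _ _).1 hu'

section ProjectiveSpace

open HomogeneousLocalization MvPolynomial

attribute [local instance] MvPolynomial.gradedAlgebra

variable (k) (n : ℕ)

theorem X_mem_homogeneousSubmodule (j : Fin (n + 1)) :
    X j ∈ homogeneousSubmodule (Fin (n + 1)) k 1 :=
  isHomogeneous_X k j

/-- The fraction `x_i / x_j` of degree zero. -/
noncomputable def awayRatio (i j : Fin (n + 1)) :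
    Away (homogeneousSubmodule (Fin (n + 1)) k) (X j) :=
  Away.mk _ (X_mem_homogeneousSubmodule k n j) 1 (X i) (X_mem_homogeneousSubmodule k n i)

theorem exists_eval₂_awayRatio_eq (j : Fin (n + 1))
    (s : Away (homogeneousSubmodule (Fin (n + 1)) k) (X j)) :
    ∃ p : MvPolynomial (Fin (n + 1)) k, p.eval₂ ((fromZeroRingHom _ _).comp
      (algebraMap k (homogeneousSubmodule (Fin (n + 1)) k 0))) (fun i ↦ awayRatio k n i j) = s := by
  obtain ⟨m, p, hp, rfl⟩ := Away.mk_surjective _ (X_mem_homogeneousSubmodule k n j) s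
  refine ⟨p, ?_⟩
  have hp' : p.IsHomogeneous m := by simpa using hp
  apply val_injective
  let A := MvPolynomial (Fin (n + 1)) k
  let L := Localization.Away (X j : A)
  change algebraMap (Away (homogeneousSubmodule (Fin (n + 1)) k) (X j)) L _ = _
  rw [hom_eval₂, Away.val_mk]
  have hx : algebraMap A L (X j) * IsLocalization.Away.invSelf (X j : A) = 1 :=
    IsLocalization.Away.mul_invSelf (X j : A)
  have hmk (a : A) (m : ℕ) (h : (X j : A) ^ m ∈ Submonoid.powers (X j : A)) :
      (Localization.mk a ⟨_, h⟩ : L) =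
        IsLocalization.Away.invSelf (X j : A) ^ m * algebraMap A L a := by
    rw [Localization.mk_eq_mk', IsLocalization.mk'_eq_iff_eq_mul, map_pow, mul_right_comm, ← mul_pow,
      mul_comm (IsLocalization.Away.invSelf _), hx, one_pow, one_mul]
  have h1 (i : Fin (n + 1)) : algebraMap (Away (homogeneousSubmodule (Fin (n + 1)) k) (X j)) L
      (awayRatio k n i j) =
      IsLocalization.Away.invSelf (X j : A) * algebraMap A L (X i) := by
    change (awayRatio k n i j).val = _
    rw [awayRatio, Away.val_mk, hmk, pow_one]
  have h2 : (algebraMap (Away (homogeneousSubmodule (Fin (n + 1)) k) (X j)) L).comp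
      ((fromZeroRingHom _ _).comp (algebraMap k (homogeneousSubmodule (Fin (n + 1)) k 0))) =
      (algebraMap A L).comp C := by
    ext c
    change Localization.mk (C c) 1 = algebraMap A L (C c)
    exact Localization.mk_one_eq_algebraMap _
  simp_rw [h1]
  rw [eval₂_mul_of_isHomogeneous _ _ _ hp', hmk, h2, ← hom_eval₂, eval₂_eta]

theorem constants_eq_awayToSection (j : Fin (n + 1)) :
    constants (projectiveSpaceStructure k n)
      (Proj.basicOpen (homogeneousSubmodule (Fin (n + 1)) k) (X j)) =
    (Proj.awayToSection (homogeneousSubmodule (Fin (n + 1)) k) (X j)).hom.comp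
      ((fromZeroRingHom _ _).comp (algebraMap k (homogeneousSubmodule (Fin (n + 1)) k 0))) := by
  set 𝒜 := homogeneousSubmodule (Fin (n + 1)) k
  refine constants_eq_of_ι_comp_eq _ _ (CommRingCat.ofHom (algebraMap k (𝒜 0)) ≫
    CommRingCat.ofHom (fromZeroRingHom 𝒜 (.powers (X j))) ≫ Proj.awayToSection 𝒜 (X j)) ?_
  have h := Proj.awayι_toSpecZero 𝒜 (X j) (X_mem_homogeneousSubmodule k n j) one_pos
  rw [← Proj.basicOpenIsoSpec_inv_ι, Category.assoc, Iso.inv_comp_eq, Proj.basicOpenIsoSpec_hom,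
    Proj.basicOpenToSpec] at h
  change (Proj.basicOpen 𝒜 (X j)).ι ≫ (Proj.toSpecZero 𝒜 ≫
    Spec.map (CommRingCat.ofHom (algebraMap k (𝒜 0))) : Proj 𝒜 ⟶ Spec (.of k)) = _
  rw [reassoc_of% h, Spec.map_comp, Spec.map_comp, Category.assoc]

theorem adjoin_range_X_eq_top :
    Algebra.adjoin (homogeneousSubmodule (Fin (n + 1)) k 0)
      (Set.range (X : Fin (n + 1) → MvPolynomial (Fin (n + 1)) k)) = ⊤ := by
  refine top_le_iff.1 fun p _ ↦ ?_
  have hp : p ∈ Algebra.adjoin k (Set.range (X : Fin (n + 1) → MvPolynomial (Fin (n + 1)) k)) := by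
    rw [MvPolynomial.adjoin_range_X]; trivial
  induction hp using Algebra.adjoin_induction with
  | mem x hx => exact Algebra.subset_adjoin hx
  | algebraMap c =>
    exact Subalgebra.algebraMap_mem _ (⟨C c, isHomogeneous_C _ c⟩ :
      homogeneousSubmodule (Fin (n + 1)) k 0)
  | add x y _ _ hx hy => exact add_mem (hx trivial) (hy trivial)
  | mul x y _ _ hx hy => exact mul_mem (hx trivial) (hy trivial)

/-- The homogeneous coordinates of `ℙⁿ`. -/
noncomputable def projectiveSpaceCoordinates :
    HomogeneousCoordinates (projectiveSpaceStructure k n) n where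
  U j := Proj.basicOpen _ (X j)
  ratio i j := Proj.awayToSection _ _ (awayRatio k n i j)
  isAffineOpen j := Proj.isAffineOpen_basicOpen _ _ (X_mem_homogeneousSubmodule k n j) one_pos
  iSup_eq_top := Proj.iSup_basicOpen_eq_top' _ _ (fun j ↦ ⟨1, X_mem_homogeneousSubmodule k n j⟩)
    (adjoin_range_X_eq_top k n)
  ratio_self j := by
    have : awayRatio k n j j = 1 := by
      apply val_injective
      rw [awayRatio, Away.val_mk, val_one]
      simp_rw [pow_one]
      exact Localization.mk_self ⟨_, _⟩
    rw [this]
    exact map_one (Proj.awayToSection _ _).hom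
  ratio_mul i j l W hj hl := by
    let 𝒜 := homogeneousSubmodule (Fin (n + 1)) k
    have hW : W ≤ Proj.basicOpen 𝒜 (X j * X l) := by
      rw [Proj.basicOpen_mul]; exact le_inf hj hl
    have hX := X_mem_homogeneousSubmodule k n
    have h (a b : Fin (n + 1)) (ha : W ≤ Proj.basicOpen 𝒜 (X a))
        (hx : (X j * X l : MvPolynomial (Fin (n + 1)) k) = X a * X b) (s : Away 𝒜 (X a)) :
        (Proj 𝒜).presheaf.map (homOfLE ha).op (Proj.awayToSection 𝒜 _ s) =
          (Proj 𝒜).presheaf.map (homOfLE hW).op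
            (Proj.awayToSection 𝒜 _ (awayMap 𝒜 (hX b) hx s)) := by
      have := ConcreteCategory.congr_hom (Proj.awayMap_awayToSection 𝒜 (hX b) hx) s
      simp only [ConcreteCategory.comp_apply] at this
      erw [this]
      exact ConcreteCategory.congr_hom ((Proj 𝒜).presheaf.map_comp _ (homOfLE hW).op)
        (Proj.awayToSection 𝒜 _ s)
    have key : awayMap 𝒜 (hX l) rfl (awayRatio k n i j) *
        awayMap 𝒜 (hX j) (mul_comm _ _) (awayRatio k n j l) =
        awayMap 𝒜 (hX j) (mul_comm (X j) (X l)) (awayRatio k n i l) := by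
      apply val_injective
      rw [awayRatio, awayRatio, awayRatio, awayMap_mk, awayMap_mk, awayMap_mk, val_mul,
        Away.val_mk, Away.val_mk, Away.val_mk, Localization.mk_mul, Localization.mk_eq_mk_iff,
        Localization.r_iff_exists]
      exact ⟨1, by simp; ring⟩
    have h1 := h j l hj rfl (awayRatio k n i j)
    have h2 := h l j hl (mul_comm _ _) (awayRatio k n j l)
    have h3 := h l j hl (mul_comm _ _) (awayRatio k n i l)
    erw [h1, h2, h3, ← map_mul, ← map_mul, key]
    rfl
  basicOpen_ratio_le i j := basicOpen_awayToSection_mk_le _ _ _ _ _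
  exists_eval₂_eq j s := by
    obtain ⟨t, rfl⟩ : ∃ t, Proj.awayToSection _ _ t = s :=
      (ConcreteCategory.bijective_of_isIso
        (Proj.basicOpenIsoAway _ _ (X_mem_homogeneousSubmodule k n j) one_pos).hom).2 s
    obtain ⟨p, rfl⟩ := exists_eval₂_awayRatio_eq k n j t
    refine ⟨p, ?_⟩
    rw [constants_eq_awayToSection]
    exact (hom_eval₂ _ _ _ _).symm

theorem universallyClosed_projectiveSpaceStructure :
    UniversallyClosed (projectiveSpaceStructure k n) := by
  let 𝒜 := homogeneousSubmodule (Fin (n + 1)) k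
  have : Algebra.FiniteType (𝒜 0) (MvPolynomial (Fin (n + 1)) k) :=
    ⟨Subalgebra.fg_def.2 ⟨_, Set.finite_range _, adjoin_range_X_eq_top k n⟩⟩
  have hbij : Function.Bijective (algebraMap k (𝒜 0)) := by
    refine ⟨fun a b h ↦ C_injective (Fin (n + 1)) k (congrArg Subtype.val h), fun ⟨p, hp⟩ ↦ ?_⟩
    have hp' : p ∈ homogeneousSubmodule (Fin (n + 1)) k 0 := hp
    rw [homogeneousSubmodule_zero, Submodule.mem_one] at hp'
    obtain ⟨c, rfl⟩ := hp'
    exact ⟨c, rfl⟩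
  have : IsIso (CommRingCat.ofHom (algebraMap k (𝒜 0))) :=
    (ConcreteCategory.isIso_iff_bijective _).2 hbij
  have h1 : UniversallyClosed (Proj.toSpecZero 𝒜) := inferInstance
  have h2 : UniversallyClosed (Spec.map (CommRingCat.ofHom (algebraMap k (𝒜 0)))) := inferInstance
  exact MorphismProperty.comp_mem _ _ _ h1 h2

end ProjectiveSpace

end Coordinates

/-! ### Invariant subsets -/

section Invariant

variable {k : Type u} [Field k] {X : Scheme.{u}} {π : X ⟶ Spec (.of k)} (v : VectorField π)

/-- A subset is invariant if `v` preserves, locally, the functions that vanish on it. -/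
theorem isInvariant_of_forall {Y : Set X} (h : ∀ x ∈ Y, ∀ (U : X.Opens), x ∈ U → ∀ f : Γ(X, U),
    (∀ y ∈ Y, y ∉ X.basicOpen f) → x ∉ X.basicOpen (v.der U f)) : v.IsInvariant Y := by
  refine fun x hx ↦ ⟨v.valueAt_mem_tangentSpace x, fun U hxU f hf ↦ ?_⟩
  refine (v.valueAt_germ x U hxU f).trans
    ((Scheme.evaluation_eq_zero_iff_notMem_basicOpen _ _ _ _).2 ?_)
  refine h x hx U hxU f fun y hy hyf ↦ ?_
  have hyU : y ∈ U := X.basicOpen_le f hyf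
  exact (Scheme.evaluation_eq_zero_iff_notMem_basicOpen _ _ _ _).1 (hf y hyU hy) hyf

/-- In a reduced scheme, the functions that vanish on the closure of an open set `W` are those whose
restriction to `W` is zero. -/
theorem isInvariant_closure [IsReduced X] (W : X.Opens) : v.IsInvariant (closure (W : Set X)) := by
  refine isInvariant_of_forall v fun x hx U hxU f hf hxf ↦ ?_
  have hle : U ⊓ W ≤ U := inf_le_left
  have hres : X.presheaf.map (homOfLE hle).op f = 0 := by
    rw [← basicOpen_eq_bot_iff, X.basicOpen_res, eq_bot_iff]
    exact fun y hy ↦ hf y (subset_closure hy.1.2) hy.2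
  obtain ⟨y, hyf, hyW⟩ := mem_closure_iff.1 hx _ (X.basicOpen (v.der U f)).isOpen hxf
  have hy : y ∈ X.basicOpen (X.presheaf.map (homOfLE hle).op (v.der U f)) := by
    rw [X.basicOpen_res]
    exact ⟨⟨X.basicOpen_le _ hyf, hyW⟩, hyf⟩
  rw [← v.der_res, hres, map_zero] at hy
  simp at hy

/-- If every invariant closed set is trivial, then `X` is irreducible, because closures of open
subsets are invariant. -/
theorem VectorField.IsWild.irreducibleSpace [IsReduced X] [Nonempty X] {v : VectorField π}
    (hv : v.IsWild) : IrreducibleSpace X := by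
  have : PreirreducibleSpace X := by
    refine ⟨fun U W hU hW ⟨x, _, hxU⟩ ⟨y, _, hyW⟩ ↦ ?_⟩
    have h := hv _ isClosed_closure ⟨x, subset_closure hxU⟩ (isInvariant_closure v ⟨U, hU⟩)
    obtain ⟨z, hzW, hzU⟩ := mem_closure_iff.1 (h ▸ Set.mem_univ y) W hW hyW
    exact ⟨z, trivial, hzU, hzW⟩
  exact ⟨‹_›⟩

theorem isUnit_natCast_succ [CharZero k] (π : X ⟶ Spec (.of k)) (U : X.Opens) (n : ℕ) :
    IsUnit ((n + 1 : ℕ) : Γ(X, U)) := by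
  have h : IsUnit ((n + 1 : ℕ) : k) := (Nat.cast_ne_zero.2 n.succ_ne_zero).isUnit
  simpa using h.map (constants π U)

/-- If `v(s)` is a multiple of the function `s`, then the functions vanishing on the zero locus of
`s` are stable under `v`, because they form the radical of the ideal generated by `s`. -/
theorem notMem_basicOpen_der [CharZero k] {U V : X.Opens} {s b : Γ(X, U)} (hs : v.der U s = b * s)
    {x : X} (hxU : x ∈ U) (hxs : x ∉ X.basicOpen s) (hxV : x ∈ V) {f : Γ(X, V)}
    (hf : ∀ y ∈ U, y ∉ X.basicOpen s → y ∉ X.basicOpen f) : x ∉ X.basicOpen (v.der V f) := by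
  obtain ⟨_, ⟨W, hW, rfl⟩, hxW, hWle⟩ := X.isBasis_affineOpens.exists_subset_of_mem_open
    (show x ∈ U ⊓ V from ⟨hxU, hxV⟩) (U ⊓ V).isOpen
  have hWU : W ≤ U := fun y hy ↦ (hWle hy).1
  have hWV : W ≤ V := fun y hy ↦ (hWle hy).2
  set s' := X.presheaf.map (homOfLE hWU).op s with hs'
  set f' := X.presheaf.map (homOfLE hWV).op f with hf'
  have hder : v.der W s' = X.presheaf.map (homOfLE hWU).op b * s' := by
    rw [v.der_res, hs, map_mul]
  have hrad : f' ∈ (Ideal.span {s'}).radical := by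
    -- `f'` vanishes on the zero locus of `s'`, so `s'` is a unit where `f'` does not vanish.
    have := hW.isLocalization_basicOpen f'
    rw [← PrimeSpectrum.basicOpen_le_basicOpen_iff,
      PrimeSpectrum.basicOpen_le_basicOpen_iff_algebraMap_isUnit (S := Γ(X, X.basicOpen f'))]
    refine RingedSpace.isUnit_of_isUnit_germ X.toSheafedSpace _ _ fun y hy ↦ ?_
    have hyW : y ∈ W := X.basicOpen_le f' hy
    have hys : y ∈ X.basicOpen s := by
      by_contra h
      rw [hf', X.basicOpen_res] at hy
      exact hf y (hWU hyW) h hy.2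
    have h := (X.mem_basicOpen s y (hWU hyW)).1 hys
    rw [← X.presheaf.germ_res_apply (homOfLE hWU) y hyW] at h
    erw [X.presheaf.germ_res_apply (homOfLE (X.basicOpen_le f')) y hy]
    exact h
  obtain ⟨m, hm⟩ := derivation_mem_radical_span (isUnit_natCast_succ π W) (v.der W) hder hrad
  obtain ⟨a, ha⟩ := Ideal.mem_span_singleton'.1 hm
  intro hx
  have hx' : x ∈ X.basicOpen (v.der W f' ^ m) := by
    have h : x ∈ X.basicOpen (v.der W f') := by
      rw [hf', v.der_res, X.basicOpen_res]
      exact ⟨hxW, hx⟩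
    rw [X.mem_basicOpen _ _ hxW, map_pow]
    exact ((X.mem_basicOpen _ _ hxW).1 h).pow m
  rw [← ha, X.basicOpen_mul, hs', X.basicOpen_res] at hx'
  exact hxs hx'.2.2

end Invariant

/-! ### Sections on an integral scheme as elements of the function field -/

section FunctionField

variable {X : Scheme.{u}} [IsIntegral X]

theorem genericPoint_mem {U : X.Opens} {x : X} (hx : x ∈ U) : genericPoint X ∈ U :=
  ((genericPoint_spec X).mem_open_set_iff U.isOpen).2 ⟨x, trivial, hx⟩

/-- On an integral scheme with `H¹(X, 𝒪_X) = 0`, a family of rational functions with regular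
differences becomes regular after subtraction of one rational function. On an irreducible space the
constant sheaf with value the function field is the skyscraper sheaf at the generic point. -/
theorem exists_germ_eq_sub_of_subsingleton_H_one
    (hcoh : Subsingleton (structureSheafCohomology X 1)) {ι : Type*} (U : ι → X.Opens)
    (hη : ∀ i, genericPoint X ∈ U i) (hU : ⨆ i, U i = ⊤) (a : ι → X.functionField)
    (ha : ∀ i j, ∃ f : Γ(X, U i ⊓ U j),
      X.presheaf.germ (U i ⊓ U j) (genericPoint X) ⟨hη i, hη j⟩ f = a i - a j) :
    ∃ c : X.functionField, ∀ i, ∃ f : Γ(X, U i),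
      X.presheaf.germ (U i) (genericPoint X) (hη i) f = a i - c := by
  let Φ := forget₂ CommRingCat.{u} RingCat.{u} ⋙ forget₂ RingCat.{u} AddCommGrpCat.{u}
  refine exists_sub_mem_range_of_subsingleton_H_one (structureSheafAb X) hcoh (genericPoint X)
    (Φ.obj X.functionField) (fun U h ↦ Φ.map (X.presheaf.germ U (genericPoint X) h)) ?_ ?_ ?_
    U hη hU a ha
  · intro U V h hp
    exact (Φ.map_comp _ _).symm.trans (congrArg Φ.map (X.presheaf.germ_res (homOfLE h) _ hp))
  · intro U hp
    exact germ_injective_of_isIntegral X (genericPoint X) hp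
  · intro U hp
    obtain rfl : U = ⊥ := eq_bot_iff.2 fun x hx ↦ (hp (genericPoint_mem hx)).elim
    exact inferInstanceAs (Subsingleton Γ(X, ⊥))

end FunctionField

/-! ### Eigenvectors -/

section Eigenvector

variable {k K : Type*} [Field k] [IsAlgClosed k] [CharZero k] [Field K] [Algebra k K]

/-- A derivation that lifts to a line bundle has an eigenvector among the global sections. As in
`finiteDimensional_of_forall_div_mem_adjoin`, the `u i` are the ratios `xᵢ / x₀` of the
homogeneous coordinates and sections are represented by their ratios to `x₀`. The lift of the
derivation `D` to the line bundle is `h ↦ D h - c * h`. -/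
theorem exists_eigenvector {ι : Type*} [Finite ι] (D : Derivation k K K) (u : ι → K) {i₀ : ι}
    (h₀ : u i₀ = 1) (c : K)
    (hD : ∀ j, u j ≠ 0 → ∀ x ∈ Algebra.adjoin k (Set.range fun i ↦ u i / u j),
      D x ∈ Algebra.adjoin k (Set.range fun i ↦ u i / u j))
    (hc : ∀ j, u j ≠ 0 → D (u j) / u j - c ∈ Algebra.adjoin k (Set.range fun i ↦ u i / u j)) :
    ∃ h : K, h ≠ 0 ∧ (∀ j, u j ≠ 0 → h / u j ∈ Algebra.adjoin k (Set.range fun i ↦ u i / u j)) ∧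
      ∃ μ : k, D h = (algebraMap k K μ + c) * h := by
  let S : Submodule k K :=
    { carrier := {h | ∀ j, u j ≠ 0 → h / u j ∈ Algebra.adjoin k (Set.range fun i ↦ u i / u j)}
      add_mem' := fun ha hb j hj ↦ by rw [add_div]; exact add_mem (ha j hj) (hb j hj)
      zero_mem' := fun j _ ↦ by rw [zero_div]; exact zero_mem _
      smul_mem' := fun a x hx j hj ↦ by
        rw [smul_div_assoc]; exact Subalgebra.smul_mem _ (hx j hj) a }
  have : FiniteDimensional k S :=
    finiteDimensional_of_forall_div_mem_adjoin u h₀ S fun h hh ↦ hh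
  let L : K →ₗ[k] K := D.toLinearMap - LinearMap.mulLeft k c
  have hL : ∀ h ∈ S, L h ∈ S := by
    intro h hh j hj
    have : L h / u j = D (h / u j) + (D (u j) / u j - c) * (h / u j) := by
      have h1 : D h = D (h / u j * u j) := by rw [div_mul_cancel₀ _ hj]
      change (D h - c * h) / u j = _
      rw [h1, D.leibniz]
      simp only [smul_eq_mul]
      field_simp
      ring
    rw [this]
    exact add_mem (hD j hj _ (hh j hj)) (mul_mem (hc j hj) (hh j hj))
  have h1 : (1 : K) ∈ S := fun j _ ↦ h₀ ▸ Algebra.subset_adjoin ⟨i₀, rfl⟩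
  have : Nontrivial S := ⟨⟨⟨1, h1⟩, 0, fun h ↦ one_ne_zero (congrArg Subtype.val h)⟩⟩
  obtain ⟨μ, hμ⟩ := Module.End.exists_eigenvalue (L.restrict hL)
  obtain ⟨⟨h, hh⟩, hev⟩ := hμ.exists_hasEigenvector
  refine ⟨h, fun h0 ↦ hev.2 (Subtype.ext h0), hh, μ, ?_⟩
  have := congrArg Subtype.val hev.apply_eq_smul
  change D h - c * h = μ • h at this
  rw [Algebra.smul_def] at this
  linear_combination this

end Eigenvector

/-! ### Vector fields and homogeneous coordinates on an integral scheme -/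

section Generic

variable {k : Type u} [Field k] {X : Scheme.{u}} [IsIntegral X] (π : X ⟶ Spec (.of k))

variable (X) in
/-- The element of the function field given by a function on a nonempty open set. -/
noncomputable def genericGerm (U : X.Opens) (hU : genericPoint X ∈ U) :
    Γ(X, U) →+* X.functionField :=
  (X.presheaf.germ U (genericPoint X) hU).hom

/-- The function field as a `k`-algebra. -/
noncomputable abbrev functionFieldAlgebra : Algebra k X.functionField :=
  ((genericGerm X ⊤ trivial).comp (constants π ⊤)).toAlgebra

theorem genericGerm_injective (U : X.Opens) (hU : genericPoint X ∈ U) :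
    Function.Injective (genericGerm X U hU) :=
  germ_injective_of_isIntegral X (genericPoint X) hU

theorem genericGerm_res {U V : X.Opens} (h : V ≤ U) (hV : genericPoint X ∈ V) (f : Γ(X, U)) :
    genericGerm X V hV (X.presheaf.map (homOfLE h).op f) = genericGerm X U (h hV) f :=
  X.presheaf.germ_res_apply (homOfLE h) _ hV f

/-- Functions with the same germ at the generic point agree where both are defined. -/
theorem res_eq_res_of_genericGerm_eq {U V : X.Opens} {s : Γ(X, U)} {t : Γ(X, V)}
    {hU : genericPoint X ∈ U} {hV : genericPoint X ∈ V}
    (h : genericGerm X U hU s = genericGerm X V hV t)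
    {W : X.Opens} (hWU : W ≤ U) (hWV : W ≤ V) :
    X.presheaf.map (homOfLE hWU).op s = X.presheaf.map (homOfLE hWV).op t := by
  by_cases hW : genericPoint X ∈ W
  · apply genericGerm_injective W hW
    rw [genericGerm_res, genericGerm_res, h]
  · obtain rfl : W = ⊥ := eq_bot_iff.2 fun x hx ↦ (hW (genericPoint_mem hx)).elim
    exact Subsingleton.elim _ _

theorem genericGerm_constants (U : X.Opens) (hU : genericPoint X ∈ U) (a : k) :
    genericGerm X U hU (constants π U a) =
      letI := functionFieldAlgebra π; algebraMap k X.functionField a := by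
  have : constants π U = (X.presheaf.map (homOfLE le_top).op).hom.comp (constants π ⊤) := by
    rw [constants, constants, ← CommRingCat.hom_comp]
    congr 1
    simp only [Category.assoc, ← X.presheaf.map_comp]
    rfl
  rw [this]
  refine (genericGerm_res le_top hU _).trans ?_
  rfl

variable {π} in
/-- The derivation of the function field induced by a vector field. -/
noncomputable def genericDer (v : VectorField π) :
    letI := functionFieldAlgebra π; Derivation k X.functionField X.functionField :=
  letI := functionFieldAlgebra π
  let D := v.stalkDer (genericPoint X)
  have hD : ∀ a : k, D (algebraMap k X.functionField a) = 0 := fun a ↦ by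
    refine (v.stalkDer_germ (genericPoint X) ⊤ trivial (constants π ⊤ a)).trans ?_
    rw [v.der_constants, map_zero]
  Derivation.mk'
    { toFun := D
      map_add' := D.map_add
      map_smul' := fun a x ↦ by
        rw [Algebra.smul_def, Algebra.smul_def]
        refine (D.leibniz _ _).trans ?_
        rw [hD]
        simp }
    D.leibniz

theorem genericDer_genericGerm (v : VectorField π) (U : X.Opens) (hU : genericPoint X ∈ U)
    (f : Γ(X, U)) :
    genericDer v (genericGerm X U hU f) = genericGerm X U hU (v.der U f) :=
  v.stalkDer_germ (genericPoint X) U hU f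

/-- A rational function that is regular on the members of an open cover is regular. -/
theorem exists_genericGerm_top_eq {ι : Type u} (U : ι → X.Opens)
    (hη : ∀ i, genericPoint X ∈ U i) (hU : ⨆ i, U i = ⊤) (f : ∀ i, Γ(X, U i))
    (x : X.functionField) (hf : ∀ i, genericGerm X (U i) (hη i) (f i) = x) :
    ∃ t : Γ(X, ⊤), ∀ i, X.presheaf.map (homOfLE le_top).op t = f i := by
  obtain ⟨t, ht, -⟩ := X.sheaf.existsUnique_gluing' U ⊤ (fun i ↦ homOfLE le_top) hU.ge f
    fun i j ↦ res_eq_res_of_genericGerm_eq ((hf i).trans (hf j).symm) inf_le_left inf_le_right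
  exact ⟨t, ht⟩

variable {π} {n : ℕ} (c : HomogeneousCoordinates π n)

namespace HomogeneousCoordinates

theorem genericGerm_ratio_mul (i : Fin (n + 1)) {j l : Fin (n + 1)} (hj : genericPoint X ∈ c.U j)
    (hl : genericPoint X ∈ c.U l) :
    genericGerm X (c.U j) hj (c.ratio i j) * genericGerm X (c.U l) hl (c.ratio j l) =
      genericGerm X (c.U l) hl (c.ratio i l) := by
  have hη : genericPoint X ∈ c.U j ⊓ c.U l := ⟨hj, hl⟩
  have h := congrArg (genericGerm X _ hη) (c.ratio_mul i j l _ inf_le_left inf_le_right)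
  rwa [map_mul, genericGerm_res, genericGerm_res, genericGerm_res] at h

theorem genericGerm_ratio_ne_zero_iff (j : Fin (n + 1)) {l : Fin (n + 1)}
    (hl : genericPoint X ∈ c.U l) :
    genericGerm X (c.U l) hl (c.ratio j l) ≠ 0 ↔ genericPoint X ∈ c.U j := by
  constructor
  · intro h
    exact c.basicOpen_ratio_le j l ((X.mem_basicOpen _ _ hl).2 (isUnit_iff_ne_zero.2 h))
  · intro hj h
    have := c.genericGerm_ratio_mul l hj hl
    rw [h, mul_zero, c.ratio_self, map_one] at this
    exact zero_ne_one this

/-- The functions on the `j`-th chart form the subalgebra of the function field generated by the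
ratios `x_i / x_j`. -/
theorem mem_adjoin_iff {j : Fin (n + 1)} (hj : genericPoint X ∈ c.U j) (x : X.functionField) :
    (letI := functionFieldAlgebra π;
      x ∈ Algebra.adjoin k (Set.range fun i ↦ genericGerm X (c.U j) hj (c.ratio i j))) ↔
      ∃ s, genericGerm X (c.U j) hj s = x := by
  let := functionFieldAlgebra π
  constructor
  · intro hx
    induction hx using Algebra.adjoin_induction with
    | mem x hx => obtain ⟨i, rfl⟩ := hx; exact ⟨_, rfl⟩
    | algebraMap r => exact ⟨_, genericGerm_constants π _ hj r⟩
    | add x y _ _ hx hy =>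
      obtain ⟨s, rfl⟩ := hx
      obtain ⟨t, rfl⟩ := hy
      exact ⟨s + t, map_add _ _ _⟩
    | mul x y _ _ hx hy =>
      obtain ⟨s, rfl⟩ := hx
      obtain ⟨t, rfl⟩ := hy
      exact ⟨s * t, map_mul _ _ _⟩
  · rintro ⟨s, rfl⟩
    obtain ⟨p, rfl⟩ := c.exists_eval₂_eq j s
    rw [MvPolynomial.hom_eval₂]
    have : (genericGerm X (c.U j) hj).comp (constants π (c.U j)) =
        algebraMap k X.functionField := RingHom.ext fun a ↦ genericGerm_constants π _ hj a
    rw [this, ← MvPolynomial.aeval_def, Algebra.adjoin_range_eq_range_aeval]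
    exact ⟨p, rfl⟩

/-- The nonempty charts cover `X`. -/
theorem iSup_generic_eq_top : ⨆ j : {j // genericPoint X ∈ c.U j}, c.U j = ⊤ := by
  refine eq_top_iff.2 fun x hx ↦ ?_
  rw [← c.iSup_eq_top] at hx
  obtain ⟨j, hj⟩ := Opens.mem_iSup.1 hx
  exact Opens.mem_iSup.2 ⟨⟨j, genericPoint_mem hj⟩, hj⟩

/-- If `H¹(X, 𝒪_X) = 0`, a vector field has an eigensection of `𝒪(1)`: functions `s j` (the
ratios of the section to the coordinates `x_j`) that transform as sections of `𝒪(1)` do, and that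
generate ideals stable under the vector field. -/
theorem exists_eigensection [IsAlgClosed k] [CharZero k]
    (hcoh : Subsingleton (structureSheafCohomology X 1)) (v : VectorField π) :
    ∃ s : ∀ j, Γ(X, c.U j), (∀ j, genericPoint X ∈ c.U j → s j ≠ 0) ∧
      (∀ i j (hi : genericPoint X ∈ c.U i) (hj : genericPoint X ∈ c.U j),
        genericGerm X (c.U i) hi (s i) =
          genericGerm X (c.U j) hj (s j) * genericGerm X (c.U i) hi (c.ratio j i)) ∧
      ∀ j, genericPoint X ∈ c.U j → ∃ b, v.der (c.U j) (s j) = b * s j := by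
  let := functionFieldAlgebra π
  obtain ⟨i₀, hi₀⟩ : ∃ i, genericPoint X ∈ c.U i :=
    Opens.mem_iSup.1 (c.iSup_eq_top ▸ Opens.mem_top (genericPoint X))
  let D := genericDer v
  let u (i : Fin (n + 1)) : X.functionField := genericGerm X (c.U i₀) hi₀ (c.ratio i i₀)
  have h₀ : u i₀ = 1 := by simp only [u, c.ratio_self, map_one]
  have hu (j : Fin (n + 1)) : u j ≠ 0 ↔ genericPoint X ∈ c.U j :=
    c.genericGerm_ratio_ne_zero_iff j hi₀
  have hdiv (i j : Fin (n + 1)) (hj : genericPoint X ∈ c.U j) :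
      u i / u j = genericGerm X (c.U j) hj (c.ratio i j) :=
    (div_eq_iff ((hu j).2 hj)).2 (c.genericGerm_ratio_mul i hj hi₀).symm
  have hadj (j : Fin (n + 1)) (hj : genericPoint X ∈ c.U j) (x : X.functionField) :
      x ∈ Algebra.adjoin k (Set.range fun i ↦ u i / u j) ↔
        ∃ s, genericGerm X (c.U j) hj s = x := by
    simp only [hdiv _ j hj]
    exact c.mem_adjoin_iff hj x
  have hlog (i j : {j // genericPoint X ∈ c.U j}) : ∃ f : Γ(X, c.U i ⊓ c.U j),
      genericGerm X (c.U i ⊓ c.U j) ⟨i.2, j.2⟩ f = D (u i) / u i - D (u j) / u j := by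
    -- The difference is the logarithmic derivative of the unit `x_i / x_j`.
    refine ⟨X.presheaf.map (homOfLE inf_le_right).op (v.der _ (c.ratio i j)) *
      X.presheaf.map (homOfLE inf_le_left).op (c.ratio j i), ?_⟩
    have hi' := (hu i).2 i.2
    have hj' := (hu j).2 j.2
    have hη : genericPoint X ∈ c.U i ⊓ c.U j := ⟨i.2, j.2⟩
    change genericGerm X _ hη _ = _
    rw [map_mul, genericGerm_res, genericGerm_res, ← genericDer_genericGerm, ← hdiv _ _ j.2,
      ← hdiv _ _ i.2]
    have h1 : D (u i) = u i / u j * D (u j) + u j * D (u i / u j) := by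
      conv_lhs => rw [← div_mul_cancel₀ (u i) hj', D.leibniz]
      rfl
    change D (u i / u j) * _ = _
    rw [h1]
    field_simp
    ring
  obtain ⟨a, ha⟩ := exists_germ_eq_sub_of_subsingleton_H_one hcoh
    (fun j : {j // genericPoint X ∈ c.U j} ↦ c.U j) (fun j ↦ j.2) c.iSup_generic_eq_top
    (fun j ↦ D (u j) / u j) hlog
  obtain ⟨h, hne, hreg, μ, hμ⟩ := exists_eigenvector D u h₀ a
    (fun j hj x hx ↦ by
      obtain ⟨s, rfl⟩ := (hadj j ((hu j).1 hj) x).1 hx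
      exact (hadj j ((hu j).1 hj) _).2 ⟨_, (genericDer_genericGerm π v _ _ s).symm⟩)
    (fun j hj ↦ (hadj j ((hu j).1 hj) _).2 (ha ⟨j, (hu j).1 hj⟩))
  have hs (j : Fin (n + 1)) : ∃ s : Γ(X, c.U j),
      ∀ hj : genericPoint X ∈ c.U j, genericGerm X (c.U j) hj s = h / u j := by
    by_cases hj : genericPoint X ∈ c.U j
    · obtain ⟨s, hs⟩ := (hadj j hj _).1 (hreg j ((hu j).2 hj))
      exact ⟨s, fun _ ↦ hs⟩
    · exact ⟨0, fun hj' ↦ (hj hj').elim⟩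
  choose s hs using hs
  refine ⟨s, fun j hj h0 ↦ ?_, fun i j hi hj ↦ ?_, fun j hj ↦ ?_⟩
  · have := hs j hj
    rw [h0, map_zero] at this
    exact div_ne_zero hne ((hu j).2 hj) this.symm
  · have hj' := (hu j).2 hj
    rw [hs i hi, hs j hj, ← hdiv j i hi]
    field_simp
  · obtain ⟨b, hb⟩ := ha ⟨j, hj⟩
    change genericGerm X (c.U j) hj b = D (u j) / u j - a at hb
    refine ⟨constants π _ μ - b, genericGerm_injective _ hj ?_⟩
    have hj' := (hu j).2 hj
    rw [map_mul, map_sub, genericGerm_constants, hb, ← genericDer_genericGerm, hs j hj]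
    have h1 : D h = h / u j * D (u j) + u j * D (h / u j) := by
      conv_lhs => rw [← div_mul_cancel₀ h hj', D.leibniz]
      rfl
    change D (h / u j) = _
    have h2 : u j * D (h / u j) = (algebraMap k X.functionField μ + a) * h - h / u j * D (u j) := by
      rw [← hμ, h1]; ring
    refine mul_left_cancel₀ hj' (h2.trans ?_)
    field_simp
    ring

end HomogeneousCoordinates

end Generic

/-! ### The zero locus of an eigensection -/

section ZeroLocus

variable {k : Type u} [Field k] {X : Scheme.{u}}

theorem topologicalKrullDim_le_zero_of_isField [IsAffine X] (h : IsField Γ(X, ⊤)) :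
    topologicalKrullDim X ≤ 0 := by
  rw [IsHomeomorph.topologicalKrullDim_eq _ X.isoSpec.hom.homeomorph.isHomeomorph]
  refine (PrimeSpectrum.topologicalKrullDim_eq_ringKrullDim (R := Γ(X, ⊤))).trans_le ?_
  exact (ringKrullDim_eq_zero_of_isField h).le

variable [IsIntegral X] {π : X ⟶ Spec (.of k)} {n : ℕ} (c : HomogeneousCoordinates π n)

/-- A section of `𝒪(1)`, given by its ratios `s j` to the coordinates `x_j`, has zeros on a proper
integral scheme of positive dimension: otherwise `x_i / s` would be a nonzero global function, hence
a constant, so `x_i` would vanish nowhere, and `X` would be affine. -/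
theorem HomogeneousCoordinates.exists_forall_notMem_basicOpen [UniversallyClosed π]
    (hdim : 1 ≤ topologicalKrullDim X) (s : ∀ j, Γ(X, c.U j))
    (hs : ∀ i j (hi : genericPoint X ∈ c.U i) (hj : genericPoint X ∈ c.U j),
        genericGerm X (c.U i) hi (s i) =
          genericGerm X (c.U j) hj (s j) * genericGerm X (c.U i) hi (c.ratio j i)) :
    ∃ j, ∃ x ∈ c.U j, x ∉ X.basicOpen (s j) := by
  by_contra! hcon
  have hunit (j : Fin (n + 1)) : IsUnit (s j) :=
    RingedSpace.isUnit_of_isUnit_germ X.toSheafedSpace _ _ fun x hx ↦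
      (X.mem_basicOpen _ x hx).1 (hcon j x hx)
  choose r hr using fun j ↦ (hunit j).exists_left_inv
  obtain ⟨i, hi⟩ : ∃ i, genericPoint X ∈ c.U i :=
    Opens.mem_iSup.1 (c.iSup_eq_top ▸ Opens.mem_top (genericPoint X))
  have hmul (j : Fin (n + 1)) (hj : genericPoint X ∈ c.U j) :
      genericGerm X (c.U j) hj (r j) * genericGerm X (c.U j) hj (s j) = 1 := by
    rw [← map_mul, hr, map_one]
  -- The functions `x_i / s` on the charts glue to a global function `t`.
  obtain ⟨t, ht⟩ := exists_genericGerm_top_eq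
    (fun j : ULift.{u} {j // genericPoint X ∈ c.U j} ↦ c.U j.down) (fun j ↦ j.down.2)
    ((Equiv.ulift.iSup_comp (g := fun j : {j // genericPoint X ∈ c.U j} ↦ c.U j)).trans
      c.iSup_generic_eq_top) (fun j ↦ r j.down * c.ratio i j.down)
    (genericGerm X (c.U i) hi (r i)) fun ⟨j, hj⟩ ↦ by
      rw [map_mul]
      have h1 := hmul i hi
      have h2 := hmul j hj
      rw [hs j i hj hi] at h2
      linear_combination genericGerm X (c.U i) hi (r i) * h2 -
        genericGerm X (c.U j) hj (r j) * genericGerm X (c.U j) hj (c.ratio i j) * h1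
  replace ht (j : Fin (n + 1)) (hj : genericPoint X ∈ c.U j) :
      X.presheaf.map (homOfLE le_top).op t = r j * c.ratio i j := ht ⟨j, hj⟩
  have hfield : IsField Γ(X, ⊤) := isField_of_universallyClosed k π
  have ht0 : t ≠ 0 := by
    rintro rfl
    have := ht i hi
    rw [map_zero, c.ratio_self, mul_one] at this
    have h1 := hmul i hi
    rw [← this, map_zero, zero_mul] at h1
    exact zero_ne_one h1
  obtain ⟨t', ht'⟩ := hfield.mul_inv_cancel ht0
  have hle (j : Fin (n + 1)) (hj : genericPoint X ∈ c.U j) : c.U j ≤ c.U i := by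
    have h1 : IsUnit (c.ratio i j) := by
      refine isUnit_of_mul_isUnit_right (x := r j) ?_
      rw [← ht j hj]
      exact (IsUnit.of_mul_eq_one _ ht').map (X.presheaf.map (homOfLE le_top).op).hom
    rw [← X.basicOpen_of_isUnit h1]
    exact c.basicOpen_ratio_le i j
  have htop : c.U i = ⊤ :=
    eq_top_iff.2 (c.iSup_generic_eq_top.ge.trans (iSup_le fun j ↦ hle j j.2))
  have : IsAffine X := by
    have h := c.isAffineOpen i
    rw [htop] at h
    have : IsAffine _ := h
    exact .of_isIso (Scheme.topIso X).inv
  exact absurd (hdim.trans (topologicalKrullDim_le_zero_of_isField hfield)) (by decide)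

/-- The zero locus of an eigensection of `𝒪(1)` shows that the vector field is not wild. -/
theorem HomogeneousCoordinates.not_isWild [CharZero k] [UniversallyClosed π]
    (hdim : 1 ≤ topologicalKrullDim X) (v : VectorField π) (s : ∀ j, Γ(X, c.U j))
    (hs₀ : ∀ j, genericPoint X ∈ c.U j → s j ≠ 0)
    (hs : ∀ i j (hi : genericPoint X ∈ c.U i) (hj : genericPoint X ∈ c.U j),
        genericGerm X (c.U i) hi (s i) =
          genericGerm X (c.U j) hj (s j) * genericGerm X (c.U i) hi (c.ratio j i))
    (hv : ∀ j, genericPoint X ∈ c.U j → ∃ b, v.der (c.U j) (s j) = b * s j) : ¬ v.IsWild := by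
  intro hwild
  -- The basic open sets of the `s j` are the traces on the `U j` of the nonvanishing locus.
  have htrace (i j : Fin (n + 1)) (x : X) (hxi : x ∈ X.basicOpen (s i)) (hxj : x ∈ c.U j) :
      x ∈ X.basicOpen (s j) := by
    have hi : genericPoint X ∈ c.U i := genericPoint_mem (X.basicOpen_le _ hxi)
    have hj : genericPoint X ∈ c.U j := genericPoint_mem hxj
    have hη : genericPoint X ∈ c.U i ⊓ c.U j := ⟨hi, hj⟩
    have heq : X.presheaf.map (homOfLE inf_le_left).op (s i) =
        X.presheaf.map (homOfLE inf_le_right).op (s j) *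
          X.presheaf.map (homOfLE inf_le_left).op (c.ratio j i) := by
      apply genericGerm_injective (c.U i ⊓ c.U j) hη
      rw [map_mul, genericGerm_res, genericGerm_res, genericGerm_res]
      exact hs i j hi hj
    have hx : x ∈ X.basicOpen
        (X.presheaf.map (homOfLE (inf_le_left : c.U i ⊓ c.U j ≤ c.U i)).op (s i)) := by
      rw [X.basicOpen_res]
      exact ⟨⟨X.basicOpen_le _ hxi, hxj⟩, hxi⟩
    rw [heq, X.basicOpen_mul, X.basicOpen_res] at hx
    exact hx.1.2
  let N : X.Opens := ⨆ j, X.basicOpen (s j)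
  have hN (j : Fin (n + 1)) (x : X) (hxj : x ∈ c.U j) : x ∈ N ↔ x ∈ X.basicOpen (s j) := by
    refine ⟨fun hx ↦ ?_, fun hx ↦ Opens.mem_iSup.2 ⟨j, hx⟩⟩
    obtain ⟨i, hi⟩ := Opens.mem_iSup.1 hx
    exact htrace i j x hi hxj
  have hne : (N : Set X)ᶜ.Nonempty := by
    obtain ⟨j, x, hxj, hx⟩ := c.exists_forall_notMem_basicOpen hdim s hs
    exact ⟨x, fun h ↦ hx ((hN j x hxj).1 h)⟩
  have hinv : v.IsInvariant (N : Set X)ᶜ := by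
    refine isInvariant_of_forall v fun x hx U hxU f hf ↦ ?_
    obtain ⟨j, hj⟩ : ∃ j, x ∈ c.U j := Opens.mem_iSup.1 (c.iSup_eq_top ▸ Opens.mem_top x)
    obtain ⟨b, hb⟩ := hv j (genericPoint_mem hj)
    exact notMem_basicOpen_der v hb hj (fun h ↦ hx ((hN j x hj).2 h)) hxU
      fun y hyj hy ↦ hf y fun h ↦ hy ((hN j y hyj).1 h)
  have huniv := hwild _ N.isOpen.isClosed_compl hne hinv
  obtain ⟨i, hi⟩ : ∃ i, genericPoint X ∈ c.U i :=
    Opens.mem_iSup.1 (c.iSup_eq_top ▸ Opens.mem_top (genericPoint X))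
  refine hs₀ i hi ((basicOpen_eq_bot_iff _).1 (eq_bot_iff.2 fun x hx ↦ ?_))
  exact huniv.ge (Set.mem_univ x) (Opens.mem_iSup.2 ⟨i, hx⟩)

end ZeroLocus

end WildVectorField

/-- Every vector field on a smooth projective variety `X` of dimension at least one over an
algebraically closed field of characteristic zero with `H¹(X, 𝒪_X) = 0` fails to be wild. -/
theorem mainTheorem6 {k : Type u} [Field k] [IsAlgClosed k] [CharZero k]
    (X : Scheme.{u}) [IsReduced X] (π : X ⟶ Spec (.of k)) [Smooth π]
    (hproj : WildVectorField.IsProjective π)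
    (hdim : 1 ≤ topologicalKrullDim X)
    (hcoh : Subsingleton (WildVectorField.structureSheafCohomology X 1))
    (v : WildVectorField.VectorField π) :
    ¬ v.IsWild := by
  intro hwild
  obtain ⟨n, i, hi, rfl⟩ := hproj
  -- The Krull dimension of the empty space is `⊥`.
  have : Nonempty X := by
    by_contra h
    rw [not_nonempty_iff] at h
    rw [topologicalKrullDim, Order.krullDim_eq_bot_iff.2] at hdim
    · exact absurd hdim (by decide)
    · exact ⟨fun s ↦ h.elim s.2.1.nonempty.some⟩
  have := hwild.irreducibleSpace
  have : IsIntegral X := isIntegral_of_irreducibleSpace_of_isReduced X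
  have := WildVectorField.universallyClosed_projectiveSpaceStructure (k := k) (n := n)
  let c := (WildVectorField.projectiveSpaceCoordinates k n).pullback i
  obtain ⟨s, hs₀, hs, hv⟩ := c.exists_eigensection hcoh v
  exact c.not_isWild hdim v s hs₀ hs hv hwild
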